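/- Let $0<\kappa<1$ and $\lambda=(1-\kappa^2)^{1/2}$. Let $p_\kappa=\wp(\,\cdot\,;g_2,g_3)$ be the Weierstrass function with invariants $$g_2=\lambda^2+\tfrac13,\qquad g_3=\tfrac13\lambda^2-\tfrac1{27},$$ and let $\mathrm{dn}_2$ be Shen's elliptic function of modulus $\kappa$, $$\mathrm{dn}_2=1-\frac{\tfrac12\kappa^2}{\tfrac13+p_\kappa}.$$ Then a Weierstrass function $p_\kappa$ with these invariants exists that has a fundamental pair of periods $(2\omega_\kappa,2\omega_\kappa')$ (that is, an $\mathbb R$-linearly independent pair whose integral combinations are exactly the periods) with $\omega_\kappa>0$ and $-i\,\omega_\kappa'>0$. For every Weierstrass function $p_\kappa$ with these invariants, such pairs for $p_\kappa$ and for $\mathrm{dn}_2$ are the same, and for every such pair the imaginary half-period is $$\omega_\kappa'=i\,\sqrt2\;\tfrac{\pi}{2}\;F\!\left(\tfrac14,\tfrac34;1;1-\kappa^2\right),$$ where $F(a,b;c;x)=\sum_{n\ge0}\frac{(a)_n(b)_n}{(c)_n}\frac{x^n}{n!}$ is the Gauss hypergeometric function. -/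

import Mathlib

open Real

/-- `p` is the Weierstrass function `℘(• ; g₂, g₃)` with invariants `g₂` and `g₃`, that is, the
Weierstrass function of a lattice whose Eisenstein sums give these invariants. -/
def IsWeierstrassFunction (p : ℂ → ℂ) (g₂ g₃ : ℂ) : Prop :=
  ∃ L : PeriodPair, L.g₂ = g₂ ∧ L.g₃ = g₃ ∧ p = L.weierstrassP

/-- `w` is a period of the meromorphic function `f`. Meromorphic functions are compared outside
discrete sets, so that the values chosen at poles and at removable singularities play no role. -/
def IsPeriodOf (f : ℂ → ℂ) (w : ℂ) : Prop :=
  (fun z => f (z + w)) =ᶠ[Filter.codiscrete ℂ] f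

/-- `(w₁, w₂)` is a fundamental pair of periods of `f`: it is linearly independent over `ℝ`, and
the periods of `f` are exactly the integral combinations of `w₁` and `w₂`. -/
def IsFundamentalPairOfPeriods (f : ℂ → ℂ) (w₁ w₂ : ℂ) : Prop :=
  LinearIndependent ℝ ![w₁, w₂] ∧
    ∀ w : ℂ, IsPeriodOf f w ↔ ∃ m n : ℤ, w = m * w₁ + n * w₂

/-- `(2ω, 2ω')` is a fundamental pair of periods of `f` such that `ω > 0` and `-i ω' > 0`. -/
structure IsNormalizedHalfPeriods (f : ℂ → ℂ) (ω ω' : ℂ) : Prop where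
  fundamental : IsFundamentalPairOfPeriods f (2 * ω) (2 * ω')
  real_pos : 0 < ω.re ∧ ω.im = 0
  imaginary_pos : ω'.re = 0 ∧ 0 < ω'.im

/-- The complementary modulus `λ = (1 - κ²)^(1/2)`. -/
noncomputable def complementaryModulus (κ : ℝ) : ℝ := √(1 - κ ^ 2)

/-- `p` is the Weierstrass function `p_κ`, with invariants `g₂ = λ² + 1/3` and
`g₃ = λ²/3 - 1/27`. -/
def IsShenWeierstrass (κ : ℝ) (p : ℂ → ℂ) : Prop :=
  IsWeierstrassFunction p
    (((complementaryModulus κ) ^ 2 + 1 / 3 : ℝ) : ℂ)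
    (((complementaryModulus κ) ^ 2 / 3 - 1 / 27 : ℝ) : ℂ)

/-- Shen's elliptic function `dn₂ = 1 - (κ²/2) / (1/3 + p_κ)`, as a meromorphic function: only
its values outside the poles of `p` and the zeros of `1/3 + p` matter. -/
noncomputable def shenDn (κ : ℝ) (p : ℂ → ℂ) (z : ℂ) : ℂ :=
  1 - ((κ : ℂ) ^ 2 / 2) / (1 / 3 + p z)

/-! `dn₂` is an injective Möbius function of `p`, so both have the same periods.

The half-period is a travel time. With `l = λ`, the cubic `4x³ - g₂x - g₃` factors as `(x + 1/3)((2x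
- 1/3)² - l²)`. On the line `Re z = ω` the function `℘` is real, and `φ(y) = ℘(ω + iy)` satisfies
`φ'² = (φ + 1/3)(l² - (2φ - 1/3)²)`. Its derivative vanishes at `y = 0` and at `y = -iω'`, but not
in between, because `℘` takes a critical value at only one point modulo the lattice
(`add_mem_lattice_of_derivWeierstrassP_eq_zero`). So `φ` runs monotonically between the roots `1/6 ±
l/2`, and the substitution `2φ - 1/3 = l cos θ` turns the time spent into `∫₀^π dθ / √(2(1 + l cos
θ))` (`transit_time`). Expanding in powers of `l cos θ` gives the hypergeometric series at `l²`.

For existence, `E₆ / E₄^(3/2)` is real on the imaginary axis, tends to `1` at infinity and changes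
sign under `t ↦ 1/t`. It therefore takes every value in `(-1, 1)`, and rescaling the lattice then
yields all real invariants with `g₂ > 0` and positive discriminant. -/

open Filter Topology in
lemma shenDn_periods_iff {κ : ℝ} (hκ : κ ≠ 0) (p : ℂ → ℂ) (w : ℂ) :
    IsPeriodOf (shenDn κ p) w ↔ IsPeriodOf p w := by
  -- With division by zero equal to `0`, the point `x = -1/3` goes to `1`, a value taken nowhere
  -- else, so injectivity holds on all of `ℂ`.
  have hinj : Function.Injective fun x : ℂ => 1 - ((κ : ℂ) ^ 2 / 2) / (1 / 3 + x) := by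
    intro x y h
    have hκ' : (κ : ℂ) ^ 2 / 2 ≠ 0 := by simpa using hκ
    simpa [div_eq_mul_inv, hκ] using h
  refine eventually_congr (Eventually.of_forall fun z => ?_)
  exact hinj.eq_iff (a := p (z + w)) (b := p z)

lemma isNormalizedHalfPeriods_shenDn_iff {κ : ℝ} (hκ : κ ≠ 0) (p : ℂ → ℂ) (ω ω' : ℂ) :
    IsNormalizedHalfPeriods (shenDn κ p) ω ω' ↔ IsNormalizedHalfPeriods p ω ω' := by
  have h : IsFundamentalPairOfPeriods (shenDn κ p) (2 * ω) (2 * ω') ↔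
      IsFundamentalPairOfPeriods p (2 * ω) (2 * ω') := by
    simp only [IsFundamentalPairOfPeriods, shenDn_periods_iff hκ]
  exact ⟨fun ⟨h₁, h₂, h₃⟩ => ⟨h.mp h₁, h₂, h₃⟩, fun ⟨h₁, h₂, h₃⟩ => ⟨h.mpr h₁, h₂, h₃⟩⟩

/-! ### Periods and critical values of the Weierstrass function -/

namespace PeriodPair

open Filter Topology

variable (L : PeriodPair)

lemma tendsto_weierstrassP_cobounded {l : ℂ} (hl : l ∈ L.lattice) :
    Tendsto L.weierstrassP (𝓝[≠] l) (Bornology.cobounded ℂ) := by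
  rw [tendsto_cobounded_iff_meromorphicOrderAt_neg (L.meromorphic_weierstrassP l),
    L.order_weierstrassP l hl]
  exact WithTop.coe_lt_coe.mpr (by norm_num : (-2 : ℤ) < 0)

lemma not_tendsto_weierstrassP_nhds {l : ℂ} (hl : l ∈ L.lattice) (p : ℂ) :
    ¬ Tendsto L.weierstrassP (𝓝[≠] l) (𝓝 p) :=
  (L.tendsto_weierstrassP_cobounded hl).not_tendsto (Metric.disjoint_nhds_cobounded p).symm

/-- A period outside the lattice would give `℘` a finite limit at its pole `0`. -/
lemma isPeriodOf_weierstrassP_iff (w : ℂ) : IsPeriodOf L.weierstrassP w ↔ w ∈ L.lattice := by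
  refine ⟨fun h => ?_, fun h => Eventually.of_forall fun z => L.weierstrassP_add_coe z ⟨w, h⟩⟩
  by_contra hw
  have h0 : (fun z => L.weierstrassP (z + w)) =ᶠ[𝓝[≠] 0] L.weierstrassP := by
    have h' := disjoint_principal_right.mp (mem_codiscrete.mp h 0)
    rwa [compl_compl] at h'
  have hc : ContinuousAt (fun z => L.weierstrassP (z + w)) 0 :=
    ContinuousAt.comp_of_eq ((L.analyticOnNhd_weierstrassP w hw).continuousAt)
      (continuous_add_const w).continuousAt (zero_add w)
  have h1 := (tendsto_congr' h0).mp (hc.tendsto.mono_left nhdsWithin_le_nhds)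
  exact L.not_tendsto_weierstrassP_nhds (zero_mem _) _ h1

/-- A doubly periodic entire function is constant. -/
lemma apply_eq_of_periodic {f : ℂ → ℂ} (hf : Differentiable ℂ f)
    (hper : ∀ z, ∀ l ∈ L.lattice, f (z + l) = f z) (z w : ℂ) : f z = f w :=
  hf.apply_eq_apply_of_bounded
    (IsZLattice.isCompact_range_of_periodic L.lattice f hf.continuous hper).isBounded z w

lemma weierstrassP_eq_weierstrassPExcept_zero_add {z : ℂ} :
    L.weierstrassP z = L.weierstrassPExcept 0 z + 1 / z ^ 2 := by
  have := L.weierstrassPExcept_add 0 z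
  simpa using this.symm

lemma add_mem_lattice_left_iff {x l : ℂ} (hl : l ∈ L.lattice) :
    x + l ∈ L.lattice ↔ x ∈ L.lattice :=
  L.lattice.toAddSubgroup.add_mem_cancel_right hl

/-- By the identity theorem on the connected complement of the lattice, a locally constant `℘` would
be constant, which its poles forbid. -/
lemma not_eventually_weierstrassP_eq (a p : ℂ) : ¬ ∀ᶠ z in 𝓝 a, L.weierstrassP z = p := by
  intro h
  have hconn : IsPreconnected ((L.lattice : Set ℂ)ᶜ) := by
    refine (Set.Countable.isPathConnected_compl_of_one_lt_rank (by simp) ?_)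
      |>.isConnected.isPreconnected
    exact (inferInstance : Countable L.lattice)
  by_cases ha : a ∈ L.lattice
  · exact L.not_tendsto_weierstrassP_nhds ha p
      (tendsto_const_nhds.congr' ((h.filter_mono nhdsWithin_le_nhds).mono fun _ => Eq.symm))
  have heq := L.analyticOnNhd_weierstrassP.eqOn_of_preconnected_of_eventuallyEq
    (analyticOnNhd_const (v := p)) hconn ha h
  refine L.not_tendsto_weierstrassP_nhds (zero_mem _) p (tendsto_const_nhds.congr' ?_)
  filter_upwards [self_mem_nhdsWithin, mem_nhdsWithin_of_mem_nhds
    (L.compl_lattice_sdiff_singleton_mem_nhds 0)] with z hz hz'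
  exact (heq (by simp_all)).symm

/-- If `℘` takes its value at a critical point `a` also at `b`, then `b` is congruent to `-a`. -/
theorem add_mem_lattice_of_derivWeierstrassP_eq_zero {a b : ℂ} (ha : a ∉ L.lattice)
    (hb : b ∉ L.lattice) (hd : L.derivWeierstrassP a = 0)
    (hab : L.weierstrassP b = L.weierstrassP a) : a + b ∈ L.lattice := by
  classical
  by_contra hcon
  set p := L.weierstrassP a with hp
  have hq : AnalyticAt ℂ (fun z => L.weierstrassP (z + a) - p) 0 :=
    AnalyticAt.sub (AnalyticAt.comp_of_eq (f := fun z => z + a)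
      (L.analyticOnNhd_weierstrassP a ha) (by fun_prop) (zero_add a)) analyticAt_const
  obtain ⟨r, hr, hqr⟩ := (natCast_le_analyticOrderAt hq (n := 2)).mp <| by
    rw [natCast_le_analyticOrderAt_iff_iteratedDeriv_eq_zero hq]
    intro i hi
    interval_cases i
    · simp [hp]
    · simp [iteratedDeriv_one, deriv_comp_add_const, hd]
  simp only [sub_zero, smul_eq_mul] at hqr
  -- The double zero of `℘(z + a) - p` at `0` cancels the double pole of `℘(z) - p`. Since `z²℘(z) →
  -- 1`, the value filled in is `r 0`. The symmetry `z ↦ -a - z` swaps the factors and carries this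
  -- to the poles at `-a`.
  let H : ℂ → ℂ := fun z => if z ∈ L.lattice ∨ z + a ∈ L.lattice then r 0 else
    (L.weierstrassP z - p) * (L.weierstrassP (z + a) - p)
  have hper : ∀ z, ∀ l ∈ L.lattice, H (z + l) = H z := by
    intro z l hl
    have e : z + l + a = z + a + l := by ring
    simp only [H, e, L.add_mem_lattice_left_iff hl, L.weierstrassP_add_coe _ ⟨l, hl⟩]
  have hsymm : ∀ z, H (-a - z) = H z := by
    intro z
    have e₁ : -a - z = -(z + a) := by ring
    have e₂ : -a - z + a = -z := by ring
    simp only [H, e₂, L.weierstrassP_neg, neg_mem_iff]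
    simp only [e₁, L.weierstrassP_neg, neg_mem_iff, or_comm, mul_comm]
  have hnear : H =ᶠ[𝓝 0] fun z =>
      (z ^ 2 * L.weierstrassPExcept 0 z + 1 - p * z ^ 2) * r z := by
    have hna : ∀ᶠ z in 𝓝 (0 : ℂ), z + a ∉ L.lattice :=
      (continuous_add_const a).continuousAt.eventually
        (L.isClosed_lattice.isOpen_compl.mem_nhds (by simpa using ha))
    filter_upwards [hqr, hna, L.compl_lattice_sdiff_singleton_mem_nhds 0] with z h₁ h₂ h₃
    by_cases hz : z = 0
    · simp [H, hz]
    have hz' : z ∉ L.lattice := by simp_all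
    simp only [H, hz', h₂, or_self, if_false, h₁, L.weierstrassP_eq_weierstrassPExcept_zero_add (z := z)]
    field
  have hH0 : AnalyticAt ℂ H 0 := by
    have := L.analyticAt_weierstrassPExcept 0
    refine AnalyticAt.congr ?_ hnear.symm
    fun_prop
  have hHl : ∀ l ∈ L.lattice, AnalyticAt ℂ H l := by
    intro l hl
    have h1 : AnalyticAt ℂ (fun z => H (z - l)) l :=
      hH0.comp_of_eq (by fun_prop) (sub_self l)
    convert h1 using 2 with z
    have := hper z (-l) (neg_mem hl)
    rw [← this, sub_eq_add_neg]
  have hH : Differentiable ℂ H := by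
    intro z
    apply AnalyticAt.differentiableAt
    by_cases hz : z ∈ L.lattice
    · exact hHl z hz
    by_cases hz' : z + a ∈ L.lattice
    · have h1 : AnalyticAt ℂ (fun w => H (-a - w)) z :=
        (hHl (-(z + a)) (neg_mem hz')).comp_of_eq (by fun_prop) (by ring)
      simpa only [hsymm] using h1
    · have h1 : AnalyticAt ℂ (fun w => L.weierstrassP (w + a)) z :=
        (L.analyticOnNhd_weierstrassP (z + a) hz').comp_of_eq (by fun_prop) rfl
      have h2 := L.analyticOnNhd_weierstrassP z hz
      have h3 : AnalyticAt ℂ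
          (fun w => (L.weierstrassP w - p) * (L.weierstrassP (w + a) - p)) z := by fun_prop
      refine h3.congr ?_
      filter_upwards [L.isClosed_lattice.isOpen_compl.mem_nhds hz,
        (continuous_add_const a).continuousAt.eventually
          (L.isClosed_lattice.isOpen_compl.mem_nhds hz')] with w hw hw'
      have hw1 : w ∉ L.lattice := hw
      have hw2 : w + a ∉ L.lattice := hw'
      simp [H, hw1, hw2]
  -- By `hcon`, `b` is not an exceptional point, so `H b` is the actual product. The constant `H` is
  -- thus zero, which forces `℘ = p` near `a`.
  have hHb : H b = 0 := by
    have : b + a ∉ L.lattice := by rwa [add_comm]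
    simp [H, hb, this, hab]
  have hzero : ∀ z, H z = 0 := fun z => (L.apply_eq_of_periodic hH hper z b).trans hHb
  have hne : ∀ᶠ z in 𝓝 (0 : ℂ), z ^ 2 * L.weierstrassPExcept 0 z + 1 - p * z ^ 2 ≠ 0 := by
    have := L.analyticAt_weierstrassPExcept 0
    have hc : ContinuousAt (fun z => z ^ 2 * L.weierstrassPExcept 0 z + 1 - p * z ^ 2) 0 :=
      AnalyticAt.continuousAt (𝕜 := ℂ) (by fun_prop)
    exact hc.eventually_ne (by simp)
  have hpa : ∀ᶠ z in 𝓝 (0 : ℂ), L.weierstrassP (z + a) = p := by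
    filter_upwards [hnear, hne, hqr] with z h₁ h₂ h₃
    rw [hzero] at h₁
    have : r z = 0 := by simpa [h₂] using h₁.symm
    rw [this, mul_zero, sub_eq_zero] at h₃
    exact h₃
  refine L.not_eventually_weierstrassP_eq a p ?_
  have : Tendsto (fun z => z - a) (𝓝 a) (𝓝 0) := by
    have := (continuous_sub_right a).tendsto a
    rwa [sub_self] at this
  simpa using this.eventually hpa

end PeriodPair

/-! ### Transit time between two roots -/

/-- The time that a solution of `φ'² = (φ + 1/3)(λ² - (2φ - 1/3)²)` takes to pass between two
distinct roots of the right-hand side. -/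
theorem transit_time_of_deriv_pos {l T : ℝ} (hl₀ : 0 < l) (hl₁ : l < 1) (hT : 0 < T)
    {φ φ' : ℝ → ℝ} (hφ : ∀ y, HasDerivAt φ (φ' y) y)
    (hode : ∀ y, φ' y ^ 2 = (φ y + 1 / 3) * (l ^ 2 - (2 * φ y - 1 / 3) ^ 2))
    (h0 : φ' 0 = 0) (h1 : φ' T = 0) (hpos : ∀ y ∈ Set.Ioo 0 T, 0 < φ' y) :
    T = ∫ θ in (0 : ℝ)..π, (√(2 * (1 + l * cos θ)))⁻¹ := by
  have hcont : Continuous φ := continuous_iff_continuousAt.mpr fun y => (hφ y).continuousAt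
  have hmono : StrictMonoOn φ (Set.Icc 0 T) := by
    refine strictMonoOn_of_deriv_pos (convex_Icc 0 T) hcont.continuousOn fun y hy => ?_
    rw [interior_Icc] at hy
    rw [(hφ y).deriv]
    exact hpos y hy
  have hroot : ∀ y, φ' y = 0 →
      φ y = -1 / 3 ∨ 2 * φ y - 1 / 3 = l ∨ 2 * φ y - 1 / 3 = -l := by
    intro y hy
    have h := hode y
    rw [hy] at h
    have : (φ y + 1 / 3) * ((l - (2 * φ y - 1 / 3)) * (l + (2 * φ y - 1 / 3))) = 0 := by
      linear_combination -h
    rcases mul_eq_zero.mp this with h | h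
    · left; linarith
    rcases mul_eq_zero.mp h with h | h
    · right; left; linarith
    · right; right; linarith
  -- As `l < 1`, the smallest of the three roots is `-1/3`, and `φ` starts at a root and increases.
  have hgt : ∀ y ∈ Set.Ioo 0 T, -1 / 3 < φ y := by
    intro y hy
    have h2 := hmono (Set.left_mem_Icc.mpr hT.le) (Set.Ioo_subset_Icc_self hy) hy.1
    rcases hroot 0 h0 with h | h | h <;> linarith
  have hlt : ∀ y ∈ Set.Ioo 0 T, (2 * φ y - 1 / 3) ^ 2 < l ^ 2 := by
    intro y hy
    have h2 := hgt y hy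
    have h3 : 0 < φ' y ^ 2 := pow_pos (hpos y hy) 2
    rw [hode y] at h3
    have := pos_of_mul_pos_right h3 (by linarith : 0 ≤ φ y + 1 / 3)
    linarith
  have habs : ∀ y ∈ Set.Ioo 0 T, -l < 2 * φ y - 1 / 3 ∧ 2 * φ y - 1 / 3 < l := fun y hy =>
    abs_lt.mp (abs_lt_of_sq_lt_sq (hlt y hy) hl₀.le)
  have hmid : T / 2 ∈ Set.Ioo 0 T := ⟨by linarith, by linarith⟩
  have hφ0 : 2 * φ 0 - 1 / 3 = -l := by
    have h2 := hmono (Set.left_mem_Icc.mpr hT.le) (Set.Ioo_subset_Icc_self hmid) hmid.1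
    have h3 := habs _ hmid
    have h4 : -l ≤ 2 * φ 0 - 1 / 3 := by
      have hcl : (0 : ℝ) ∈ closure (Set.Ioo 0 T) := by
        rw [closure_Ioo hT.ne]; exact Set.left_mem_Icc.mpr hT.le
      have hc : IsClosed {y | -l ≤ 2 * φ y - 1 / 3} :=
        isClosed_le continuous_const (by fun_prop)
      exact closure_minimal (fun y hy => (habs y hy).1.le) hc hcl
    rcases hroot 0 h0 with h | h | h <;> linarith
  have hφT : 2 * φ T - 1 / 3 = l := by
    have h2 := hmono (Set.Ioo_subset_Icc_self hmid) (Set.right_mem_Icc.mpr hT.le) hmid.2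
    have h3 := habs _ hmid
    rcases hroot T h1 with h | h | h <;> linarith
  have hkpos : ∀ θ : ℝ, 0 < 2 * (1 + l * cos θ) := by
    intro θ
    nlinarith [neg_one_le_cos θ]
  have hk : Continuous fun θ : ℝ => (√(2 * (1 + l * cos θ)))⁻¹ :=
    Continuous.inv₀ (by fun_prop) fun θ => (sqrt_pos.mpr (hkpos θ)).ne'
  -- `Φ y` is the time left before `T`, written with `2φ - 1/3 = l cos θ`; hence its derivative
  -- `-1`. The mean value theorem needs only continuity at the endpoints, where `arccos` is not
  -- differentiable.
  set Φ : ℝ → ℝ := fun y =>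
    ∫ θ in (0 : ℝ)..arccos ((2 * φ y - 1 / 3) / l), (√(2 * (1 + l * cos θ)))⁻¹ with hΦ
  have hHd : ∀ x, HasDerivAt (fun x => ∫ θ in (0 : ℝ)..x, (√(2 * (1 + l * cos θ)))⁻¹)
      ((√(2 * (1 + l * cos x)))⁻¹) x := fun x =>
    intervalIntegral.integral_hasDerivAt_right (hk.intervalIntegrable _ _)
      hk.aestronglyMeasurable.stronglyMeasurableAtFilter hk.continuousAt
  have hΦcont : Continuous Φ := by
    have h1 : Continuous (fun x => ∫ θ in (0 : ℝ)..x, (√(2 * (1 + l * cos θ)))⁻¹) :=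
      continuous_iff_continuousAt.mpr fun x => (hHd x).continuousAt
    exact h1.comp (continuous_arccos.comp (by fun_prop))
  have hΦd : ∀ y ∈ Set.Ioo 0 T, HasDerivAt Φ (-1) y := by
    intro y hy
    have hu := habs y hy
    obtain ⟨u, hu_def⟩ : ∃ u, u = (2 * φ y - 1 / 3) / l := ⟨_, rfl⟩
    have hu1 : -1 < u := by rw [hu_def, lt_div_iff₀ hl₀]; linarith
    have hu2 : u < 1 := by rw [hu_def, div_lt_iff₀ hl₀]; linarith
    have hud : HasDerivAt (fun y => (2 * φ y - 1 / 3) / l) (2 * φ' y / l) y :=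
      (((hφ y).const_mul 2).sub_const _).div_const l
    have hacos : HasDerivAt (fun y => arccos ((2 * φ y - 1 / 3) / l))
        (-(1 / √(1 - u ^ 2)) * (2 * φ' y / l)) y :=
      HasDerivAt.comp (h₂ := arccos) y (hu_def ▸ hasDerivAt_arccos hu1.ne' hu2.ne) hud
    have h := HasDerivAt.comp y (hu_def ▸ hHd (arccos u)) hacos
    rw [← hu_def, cos_arccos hu1.le hu2.le] at h
    refine h.congr_deriv ?_
    have hlu : l * u = 2 * φ y - 1 / 3 := by rw [hu_def]; field
    have hB : 0 < 1 - u ^ 2 := by nlinarith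
    have hA : 0 < 2 * (1 + l * u) := by rw [hlu]; linarith [hgt y hy]
    have hAs := sq_sqrt hA.le
    have hBs := sq_sqrt hB.le
    have hA' := sqrt_pos.mpr hA
    have hB' := sqrt_pos.mpr hB
    have key : 2 * φ' y = √(2 * (1 + l * u)) * l * √(1 - u ^ 2) := by
      refine (pow_left_inj₀ (by linarith [hpos y hy]) (by positivity) two_ne_zero).mp ?_
      have hφu : φ y = (l * u + 1 / 3) / 2 := by rw [hlu]; ring
      rw [mul_pow, mul_pow, mul_pow, hAs, hBs, hode y, hφu]
      ring
    rw [key]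
    field
  obtain ⟨c, -, hc⟩ := exists_hasDerivAt_eq_slope Φ (fun _ => -1) hT hΦcont.continuousOn hΦd
  have e0 : Φ 0 = ∫ θ in (0 : ℝ)..π, (√(2 * (1 + l * cos θ)))⁻¹ := by
    simp only [hΦ, hφ0, neg_div, div_self hl₀.ne', arccos_neg_one]
  have e1 : Φ T = 0 := by
    simp only [hΦ, hφT, div_self hl₀.ne', arccos_one, intervalIntegral.integral_same]
  rw [← e0]
  rw [e1, sub_zero, eq_div_iff hT.ne'] at hc
  linarith

/-- By Darboux, `φ'` has constant sign; reversing time reduces the negative case to the positive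
one. -/
theorem transit_time {l T : ℝ} (hl₀ : 0 < l) (hl₁ : l < 1) (hT : 0 < T)
    {φ φ' : ℝ → ℝ} (hφ : ∀ y, HasDerivAt φ (φ' y) y)
    (hode : ∀ y, φ' y ^ 2 = (φ y + 1 / 3) * (l ^ 2 - (2 * φ y - 1 / 3) ^ 2))
    (h0 : φ' 0 = 0) (h1 : φ' T = 0) (hne : ∀ y ∈ Set.Ioo 0 T, φ' y ≠ 0) :
    T = ∫ θ in (0 : ℝ)..π, (√(2 * (1 + l * cos θ)))⁻¹ := by
  rcases hasDerivWithinAt_forall_lt_or_forall_gt_of_forall_ne (convex_Ioo 0 T)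
    (fun y _ => (hφ y).hasDerivWithinAt) hne with h | h
  · refine transit_time_of_deriv_pos hl₀ hl₁ hT (φ := fun y => φ (T - y))
      (φ' := fun y => -φ' (T - y)) (fun y => ?_) (fun y => ?_) (by simp [h1]) (by simp [h0])
      fun y hy => ?_
    · simpa using (hφ (T - y)).comp_const_sub T y
    · simpa using hode (T - y)
    · simpa using h (T - y) ⟨by linarith [hy.2], by linarith [hy.1]⟩
  · exact transit_time_of_deriv_pos hl₀ hl₁ hT hφ hode h0 h1 h

/-! ### The integral as a hypergeometric series -/

lemma integral_cos_pow_zero_pi_succ_succ (n : ℕ) :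
    ∫ x in (0 : ℝ)..π, cos x ^ (n + 2) = (n + 1) / (n + 2) * ∫ x in (0 : ℝ)..π, cos x ^ n := by
  simp [integral_cos_pow]

lemma integral_cos_pow_odd_zero_pi (n : ℕ) : ∫ x in (0 : ℝ)..π, cos x ^ (2 * n + 1) = 0 := by
  induction n with
  | zero => simp
  | succ n ih =>
    rw [show 2 * (n + 1) + 1 = 2 * n + 1 + 2 by ring, integral_cos_pow_zero_pi_succ_succ, ih,
      mul_zero]

/-- Both sides are multiplied by `(1/4 + n)(3/4 + n) / (n + 1)²` when `n` increases by one. -/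
lemma choose_neg_half_two_mul_mul_integral (n : ℕ) :
    Ring.choose (-1 / 2 : ℝ) (2 * n) * ∫ x in (0 : ℝ)..π, cos x ^ (2 * n) =
      π * ordinaryHypergeometricCoefficient (1 / 4 : ℝ) (3 / 4) 1 n := by
  have hsucc : ∀ k : ℕ, Ring.choose (-1 / 2 : ℝ) (k + 1) * (k + 1) =
      Ring.choose (-1 / 2 : ℝ) k * (-1 / 2 - k) := by
    intro k
    have h (k : ℕ) : Ring.choose (-1 / 2 : ℝ) k = (k.factorial : ℝ)⁻¹ *
        (descPochhammer ℤ k).smeval (-1 / 2 : ℝ) := Ring.choose_eq_smul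
    rw [h, h, descPochhammer_succ_right, Polynomial.smeval_mul, Nat.factorial_succ]
    have : (k.factorial : ℝ) ≠ 0 := by exact_mod_cast k.factorial_ne_zero
    simp [Polynomial.smeval_sub, Polynomial.smeval_natCast]
    field
  induction n with
  | zero => simp [ordinaryHypergeometricCoefficient]
  | succ n ih =>
    have h1 := hsucc (2 * n)
    have h2 := hsucc (2 * n + 1)
    rw [show 2 * (n + 1) = 2 * n + 1 + 1 by ring] at *
    rw [integral_cos_pow_zero_pi_succ_succ (2 * n)]
    simp only [ordinaryHypergeometricCoefficient, ascPochhammer_succ_eval, Nat.factorial_succ,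
      ascPochhammer_eval_one] at ih ⊢
    have : (n.factorial : ℝ) ≠ 0 := by exact_mod_cast n.factorial_ne_zero
    push_cast at *
    have h3 : Ring.choose (-1 / 2 : ℝ) (2 * n + 1 + 1) * ((2 * n + 1) * (2 * n + 2)) =
        Ring.choose (-1 / 2 : ℝ) (2 * n) * (4 * (1 / 4 + n) * (3 / 4 + n)) := by
      linear_combination (2 * (n : ℝ) + 1) * h2 + (-1 / 2 - (2 * (n : ℝ) + 1)) * h1
    have h4 : Ring.choose (-1 / 2 : ℝ) (2 * n + 1 + 1) = Ring.choose (-1 / 2 : ℝ) (2 * n) *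
        (4 * (1 / 4 + n) * (3 / 4 + n)) / ((2 * n + 1) * (2 * n + 2)) := by
      rw [eq_div_iff (by positivity), h3]
    rw [h4]
    calc _ = (Ring.choose (-1 / 2 : ℝ) (2 * n) * ∫ x in (0 : ℝ)..π, cos x ^ (2 * n)) *
          ((1 / 4 + n) * (3 / 4 + n)) / (n + 1) ^ 2 := by field
      _ = _ := by rw [ih]; field

/-- The binomial series is integrated termwise, dominated by its absolute values at `l`; the odd
powers of `cos` integrate to zero. -/
theorem integral_inv_sqrt_one_add_mul_cos {l : ℝ} (hl₀ : 0 ≤ l) (hl₁ : l < 1) :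
    ∫ θ in (0 : ℝ)..π, (√(2 * (1 + l * cos θ)))⁻¹ =
      √2 * (π / 2) * ₂F₁ (1 / 4 : ℝ) (3 / 4 : ℝ) (1 : ℝ) (l ^ 2) := by
  have hsum : ∀ x : ℝ, |x| < 1 →
      HasSum (fun n => Ring.choose (-1 / 2 : ℝ) n * x ^ n) ((1 + x) ^ (-1 / 2 : ℝ)) := by
    intro x hx
    have h := (one_add_rpow_hasFPowerSeriesOnBall_zero (a := -1 / 2)).hasSum (y := x)
      (by simpa [enorm_eq_nnnorm, ← NNReal.coe_lt_coe] using hx)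
    simpa [binomialSeries, FormalMultilinearSeries.ofScalars_apply_eq, mul_comm] using h
  have habs : ∀ θ, |l * cos θ| ≤ l := fun θ => by
    rw [abs_mul, abs_of_nonneg hl₀]
    exact mul_le_of_le_one_right hl₀ (abs_cos_le_one θ)
  have hint : HasSum (fun n => ∫ θ in (0 : ℝ)..π, Ring.choose (-1 / 2 : ℝ) n * (l * cos θ) ^ n)
      (∫ θ in (0 : ℝ)..π, (1 + l * cos θ) ^ (-1 / 2 : ℝ)) := by
    refine intervalIntegral.hasSum_integral_of_dominated_convergence
      (fun n _ => |Ring.choose (-1 / 2 : ℝ) n * l ^ n|)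
      (fun n => Continuous.aestronglyMeasurable (by fun_prop)) (fun n => ?_) ?_ ?_ ?_
    · refine .of_forall fun θ _ => ?_
      rw [norm_mul, norm_eq_abs, norm_pow, norm_eq_abs, abs_mul (Ring.choose _ _),
        abs_of_nonneg (pow_nonneg hl₀ n)]
      gcongr
      exact habs θ
    · exact .of_forall fun θ _ => (hsum l (by rwa [abs_of_nonneg hl₀])).summable.abs
    · exact intervalIntegrable_const
    · exact .of_forall fun θ _ => hsum _ ((habs θ).trans_lt hl₁)
  have heven : HasSum (fun n => π * (ordinaryHypergeometricCoefficient (1 / 4 : ℝ) (3 / 4) 1 n *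
      (l ^ 2) ^ n)) (∫ θ in (0 : ℝ)..π, (1 + l * cos θ) ^ (-1 / 2 : ℝ)) := by
    rw [← (mul_right_injective₀ (two_ne_zero (α := ℕ))).hasSum_iff] at hint
    · convert hint using 2 with n
      simp only [Function.comp, mul_pow, intervalIntegral.integral_const_mul]
      rw [mul_left_comm (Ring.choose (-1 / 2 : ℝ) (2 * n)), choose_neg_half_two_mul_mul_integral]
      ring
    · intro n hn
      obtain ⟨k, rfl⟩ : Odd n := by
        rw [← Nat.not_even_iff_odd]
        rintro ⟨k, rfl⟩
        exact hn ⟨k, by simp [two_mul]⟩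
      simp [mul_pow, integral_cos_pow_odd_zero_pi]
  have hF : ∑' n, (ordinaryHypergeometricCoefficient (1 / 4 : ℝ) (3 / 4) 1 n * (l ^ 2) ^ n) =
      ₂F₁ (1 / 4 : ℝ) (3 / 4 : ℝ) (1 : ℝ) (l ^ 2) := by
    simp only [ordinaryHypergeometric_eq_tsum, smul_eq_mul]
  rw [← hF]
  have key : ∀ θ, (√(2 * (1 + l * cos θ)))⁻¹ = √2 / 2 * (1 + l * cos θ) ^ (-1 / 2 : ℝ) := by
    intro θ
    have hpos : 0 ≤ 1 + l * cos θ := by linarith [neg_abs_le (l * cos θ), habs θ]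
    rw [neg_div, rpow_neg hpos, ← sqrt_eq_rpow, sqrt_mul two_pos.le, mul_inv]
    congr 1
    rw [sqrt_div_self', one_div]
  simp_rw [key]
  rw [intervalIntegral.integral_const_mul, ← heven.tsum_eq, tsum_mul_left]
  ring

/-! ### Eisenstein series on the imaginary axis -/

section EisensteinImaginaryAxis

open UpperHalfPlane ModularForm EisensteinSeries Filter Topology
open scoped ArithmeticFunction.sigma MatrixGroups

lemma coe_ofComplex_I_mul {t : ℝ} (ht : 0 < t) :
    ((ofComplex (Complex.I * t) : ℍ) : ℂ) = Complex.I * t := by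
  rw [ofComplex_apply_of_im_pos (by simpa using ht)]

/-- The normalised Eisenstein series of weight `k` on the imaginary axis. -/
noncomputable def eisensteinImagAxis {k : ℕ} (hk : 3 ≤ k) (t : ℝ) : ℝ :=
  (E hk (ofComplex (Complex.I * t))).re

/-- At `it` the nome is `e^(-2πt)` and the `q`-expansion has rational coefficients, so the value is
real. -/
lemma E_ofComplex_I_mul_eq {k : ℕ} (hk : 3 ≤ k) (hk2 : Even k) {t : ℝ} (ht : 0 < t) :
    E hk (ofComplex (Complex.I * t)) = ((1 - (2 * k / bernoulli k : ℚ) *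
      ∑' n : ℕ+, (σ (k - 1) n : ℝ) * rexp (-(2 * π * t)) ^ (n : ℕ) : ℝ) : ℂ) := by
  rw [q_expansion_bernoulli hk hk2, coe_ofComplex_I_mul ht]
  have : 2 * (π : ℂ) * Complex.I * (Complex.I * t) = ((-(2 * π * t) : ℝ) : ℂ) := by
    push_cast
    linear_combination (2 * π * t : ℂ) * Complex.I_sq
  rw [this, ← Complex.ofReal_exp]
  push_cast
  simp

lemma E_ofComplex_I_mul {k : ℕ} (hk : 3 ≤ k) (hk2 : Even k) {t : ℝ} (ht : 0 < t) :
    E hk (ofComplex (Complex.I * t)) = eisensteinImagAxis hk t := by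
  rw [eisensteinImagAxis, E_ofComplex_I_mul_eq hk hk2 ht, Complex.ofReal_re]

lemma eisensteinImagAxis_four_pos {t : ℝ} (ht : 0 < t) :
    0 < eisensteinImagAxis (k := 4) (by norm_num) t := by
  rw [eisensteinImagAxis, E_ofComplex_I_mul_eq _ (by decide) ht, Complex.ofReal_re,
    bernoulli_eq_bernoulli'_of_ne_one (by norm_num), bernoulli'_four]
  have : 0 ≤ ∑' n : ℕ+, (σ (4 - 1) n : ℝ) * rexp (-(2 * π * t)) ^ (n : ℕ) :=
    tsum_nonneg fun n => by positivity
  norm_num at this ⊢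
  linarith

lemma E_ofComplex_I_mul_inv {k : ℕ} (hk : 3 ≤ k) {t : ℝ} (ht : 0 < t) :
    E hk (ofComplex (Complex.I * (t⁻¹ : ℝ))) =
      (Complex.I * t) ^ k * E hk (ofComplex (Complex.I * t)) := by
  have h := congrFun (SlashInvariantForm.slash_action_eqn (E hk)
    (Matrix.SpecialLinearGroup.mapGL ℝ ModularGroup.S) ⟨_, rfl⟩) (ofComplex (Complex.I * t))
  change ((E hk : ℍ → ℂ) ∣[(k : ℤ)] ModularGroup.S) _ = _ at h
  rw [SlashInvariantForm.slash_S_apply] at h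
  have hpoint : (ofComplex (Complex.I * (t⁻¹ : ℝ)) : ℍ) =
      .mk _ (ofComplex (Complex.I * t) : ℍ).im_inv_neg_coe_pos := by
    ext
    simp only [coe_ofComplex_I_mul ht, coe_ofComplex_I_mul (inv_pos.mpr ht)]
    push_cast
    rw [inv_neg, mul_inv, Complex.inv_I]
    ring
  rw [← hpoint, coe_ofComplex_I_mul ht] at h
  rw [← h, mul_left_comm, zpow_neg, zpow_natCast,
    mul_inv_cancel₀ (pow_ne_zero _ (by simp [ht.ne'])), mul_one]

lemma eisensteinImagAxis_four_inv {t : ℝ} (ht : 0 < t) :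
    eisensteinImagAxis (k := 4) (by norm_num) t⁻¹ =
      t ^ 4 * eisensteinImagAxis (k := 4) (by norm_num) t := by
  have h := E_ofComplex_I_mul_inv (k := 4) (by norm_num) ht
  rw [E_ofComplex_I_mul _ (by decide) ht, E_ofComplex_I_mul _ (by decide) (inv_pos.mpr ht),
    mul_pow, Complex.I_pow_four, one_mul] at h
  exact_mod_cast h

lemma eisensteinImagAxis_six_inv {t : ℝ} (ht : 0 < t) :
    eisensteinImagAxis (k := 6) (by norm_num) t⁻¹ =
      -(t ^ 6 * eisensteinImagAxis (k := 6) (by norm_num) t) := by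
  have h := E_ofComplex_I_mul_inv (k := 6) (by norm_num) ht
  rw [E_ofComplex_I_mul _ (by decide) ht, E_ofComplex_I_mul _ (by decide) (inv_pos.mpr ht),
    mul_pow, show Complex.I ^ 6 = -1 by rw [show 6 = 4 + 2 by rfl, pow_add]; simp,
    neg_one_mul, neg_mul] at h
  exact_mod_cast h

lemma tendsto_E_atImInfty {k : ℕ} (hk : 3 ≤ k) (hk2 : Even k) :
    Tendsto (E hk) atImInfty (𝓝 1) := by
  have han : AnalyticAt ℂ (cuspFunction 1 (E hk)) 0 :=
    ModularFormClass.analyticAt_cuspFunction_zero _ one_pos one_mem_strictPeriods_SL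
  have h0 : cuspFunction 1 (E hk) 0 = 1 := by
    rw [← E_qExpansion_coeff_zero hk hk2]
    simp [qExpansion_coeff]
  have h := han.continuousAt.tendsto.comp (qParam_tendsto_atImInfty one_pos)
  rw [h0] at h
  refine h.congr fun τ => ?_
  exact SlashInvariantFormClass.eq_cuspFunction _ τ one_mem_strictPeriods_SL one_ne_zero

lemma tendsto_eisensteinImagAxis {k : ℕ} (hk : 3 ≤ k) (hk2 : Even k) :
    Tendsto (eisensteinImagAxis hk) atTop (𝓝 1) := by
  have h1 : Tendsto (fun t : ℝ => Complex.I * t) atTop (comap Complex.im atTop) := by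
    rw [tendsto_comap_iff]
    simpa [Function.comp_def] using! tendsto_id (α := ℝ) (x := atTop)
  exact (Complex.continuous_re.tendsto 1).comp
    ((tendsto_E_atImInfty hk hk2).comp (tendsto_comap_im_ofComplex.comp h1))

lemma continuousOn_eisensteinImagAxis {k : ℕ} (hk : 3 ≤ k) :
    ContinuousOn (eisensteinImagAxis hk) (Set.Ioi 0) := by
  intro t ht
  have ht : 0 < t := ht
  have h1 : ContinuousAt (fun z : ℂ => E hk (ofComplex z)) (Complex.I * t) := by
    have hm := UpperHalfPlane.mdifferentiable_iff.mp (ModularFormClass.holo (E hk))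
    exact (hm.differentiableAt (isOpen_upperHalfPlaneSet.mem_nhds
      (by simpa using ht))).continuousAt
  have h2 : ContinuousAt (fun t : ℝ => E hk (ofComplex (Complex.I * t))) t :=
    ContinuousAt.comp (f := fun t : ℝ => Complex.I * t) h1 (by fun_prop)
  exact (Complex.continuous_re.continuousAt.comp h2).continuousWithinAt

/-- The quotient `E₆ / E₄^(3/2)` takes on the imaginary axis every value between `-1` and `1`. -/
theorem exists_eisensteinImagAxis_six_eq {r : ℝ} (hr₁ : -1 < r) (hr₂ : r < 1) :
    ∃ t : ℝ, 0 < t ∧ eisensteinImagAxis (k := 6) (by norm_num) t =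
      r * √(eisensteinImagAxis (k := 4) (by norm_num) t) ^ 3 := by
  set e₄ := eisensteinImagAxis (k := 4) (by norm_num) with he₄
  set e₆ := eisensteinImagAxis (k := 6) (by norm_num) with he₆
  set f : ℝ → ℝ := fun t => e₆ t / √(e₄ t) ^ 3 with hf
  have hs : ∀ t, 0 < t → 0 < √(e₄ t) ^ 3 := fun t ht =>
    pow_pos (sqrt_pos.mpr (eisensteinImagAxis_four_pos ht)) 3
  have hcont : ContinuousOn f (Set.Ioi 0) :=
    (continuousOn_eisensteinImagAxis _).div
      (((continuousOn_eisensteinImagAxis _).sqrt).pow 3) fun t ht => (hs t ht).ne'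
  have hlim : Tendsto f atTop (𝓝 1) := by
    have h₆ : Tendsto e₆ atTop (𝓝 1) := tendsto_eisensteinImagAxis _ (by decide)
    have h₄ : Tendsto e₄ atTop (𝓝 1) := tendsto_eisensteinImagAxis _ (by decide)
    have := h₆.div ((h₄.sqrt).pow 3) (by simp)
    simpa using! this
  -- The weight factors `t⁶` and `(t⁴)^(3/2)` cancel, leaving the sign `i⁶ = -1`.
  have hinv : ∀ t, 0 < t → f t⁻¹ = -f t := by
    intro t ht
    have h := (sqrt_pos.mpr (eisensteinImagAxis_four_pos ht)).ne'
    simp only [hf, he₄, he₆, eisensteinImagAxis_four_inv ht, eisensteinImagAxis_six_inv ht]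
    rw [show t ^ 4 = (t ^ 2) ^ 2 by ring, sqrt_mul (by positivity), sqrt_sq (by positivity)]
    field
  obtain ⟨b, hb0, hb⟩ := ((eventually_gt_atTop (0 : ℝ)).and (hlim.eventually (lt_mem_nhds hr₂))).exists
  obtain ⟨a, ha0, ha⟩ := ((eventually_gt_atTop (0 : ℝ)).and
    (hlim.eventually (lt_mem_nhds (show -r < 1 by linarith)))).exists
  have ha' : f a⁻¹ < r := by rw [hinv a ha0]; linarith
  obtain ⟨t, ht, hft⟩ := isPreconnected_Ioi.intermediate_value (inv_pos.mpr ha0 : a⁻¹ ∈ Set.Ioi 0)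
    (hb0 : b ∈ Set.Ioi 0) hcont ⟨ha'.le, hb.le⟩
  exact ⟨t, ht, (div_eq_iff (hs t ht).ne').mp hft⟩

lemma PeriodPair.G_eq_mul_E (L : PeriodPair) (τ : ℍ) (h : L.ω₂ = L.ω₁ * τ) {k : ℕ} (hk : 3 ≤ k) :
    L.G k = (L.ω₁ ^ k)⁻¹ * (2 * riemannZeta k * E hk τ) := by
  have h1 : E hk τ = 1 / 2 * eisensteinSeries (N := 1) 0 k τ := rfl
  rw [h1, show 2 * riemannZeta k * (1 / 2 * eisensteinSeries (N := 1) 0 k τ) =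
    riemannZeta k * eisensteinSeries (N := 1) 0 k τ by ring,
    ← tsum_eisSummand_eq_riemannZeta_mul_eisensteinSeries hk, ← tsum_mul_left, PeriodPair.G]
  -- The swap is needed because `eisSummand` attaches the first coordinate to `τ`, that is to `ω₂`.
  let e : (Fin 2 → ℤ) ≃ L.lattice :=
    (finTwoArrowEquiv ℤ).trans ((Equiv.prodComm ℤ ℤ).trans L.latticeEquivProd.symm.toEquiv)
  rw [← e.tsum_eq]
  refine tsum_congr fun v => ?_
  have : ((e v : L.lattice) : ℂ) = L.ω₁ * (v 0 * τ + v 1) := by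
    simp only [e, Equiv.trans_apply, LinearEquiv.coe_toEquiv, PeriodPair.latticeEquiv_symm_apply,
      finTwoArrowEquiv_apply, Equiv.prodComm_apply, Prod.swap, h]
    change (v 1 : ℂ) * L.ω₁ + v 0 * (L.ω₁ * τ) = _
    ring
  rw [this, mul_pow, mul_inv, eisSummand, zpow_neg, zpow_natCast]

end EisensteinImaginaryAxis

/-! ### Rectangular lattices with prescribed invariants -/

lemma riemannZeta_six : riemannZeta 6 = (π : ℂ) ^ 6 / 945 := by
  have h := riemannZeta_two_mul_nat (k := 3) (by norm_num)
  rw [show 2 * 3 = 6 by rfl, show bernoulli 6 = 1 / 42 by decide +kernel] at h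
  norm_num [Nat.factorial] at h
  rw [h]
  ring

open UpperHalfPlane in
/-- Real invariants with positive `g₂` and positive discriminant belong to a rectangular lattice. -/
theorem exists_rectangular_periodPair {g₂ g₃ : ℝ} (hg₂ : 0 < g₂)
    (hdisc : 27 * g₃ ^ 2 < g₂ ^ 3) :
    ∃ (L : PeriodPair) (a b : ℝ), 0 < a ∧ 0 < b ∧ L.ω₁ = a ∧ L.ω₂ = Complex.I * b ∧
      L.g₂ = g₂ ∧ L.g₃ = g₃ := by
  obtain ⟨B, hB, hBg⟩ : ∃ B : ℝ, 0 < B ∧ B ^ 2 = g₂ := ⟨√g₂, sqrt_pos.mpr hg₂, sq_sqrt hg₂.le⟩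
  obtain ⟨S, hS, hS3⟩ : ∃ S : ℝ, 0 < S ∧ S ^ 2 = 3 :=
    ⟨√3, sqrt_pos.mpr (by norm_num), sq_sqrt (by norm_num)⟩
  -- For periods `c` and `ict`, `g₂ = (4π⁴/3)E₄/c⁴` and `g₃ = (8π⁶/27)E₆/c⁶`, so `E₆/E₄^(3/2)` must
  -- equal `3√3 g₃/g₂^(3/2)`. The scale `c` is then fixed by `g₂`.
  have hr : |3 * S * g₃ / B ^ 3| < 1 := by
    rw [← sq_lt_one_iff_abs_lt_one, div_pow, div_lt_one (by positivity), mul_pow, mul_pow,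
      hS3, ← pow_mul, show 3 * 2 = 2 * 3 by rfl, pow_mul, hBg]
    linarith
  obtain ⟨t, ht, h6⟩ := exists_eisensteinImagAxis_six_eq (abs_lt.mp hr).1 (abs_lt.mp hr).2
  have h4 := eisensteinImagAxis_four_pos ht
  obtain ⟨A, hA, hA4⟩ : ∃ A : ℝ, 0 < A ∧ A ^ 2 = eisensteinImagAxis (k := 4) (by norm_num) t :=
    ⟨_, sqrt_pos.mpr h4, sq_sqrt h4.le⟩
  rw [← hA4, sqrt_sq hA.le] at h6
  obtain ⟨c, hc, hc2⟩ : ∃ c : ℝ, 0 < c ∧ c ^ 2 = 2 * π ^ 2 * A / (S * B) :=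
    ⟨√(2 * π ^ 2 * A / (S * B)), sqrt_pos.mpr (by positivity), sq_sqrt (by positivity)⟩
  have hindep : LinearIndependent ℝ ![(c : ℂ), Complex.I * (c * t : ℝ)] := by
    rw [LinearIndependent.pair_iff]
    intro x y hxy
    have h1 := congrArg Complex.re hxy
    have h2 := congrArg Complex.im hxy
    simp [hc.ne', ht.ne'] at h1 h2
    exact ⟨h1, h2⟩
  have hτ : (Complex.I * (c * t : ℝ) : ℂ) = c * (ofComplex (Complex.I * t) : ℍ) := by
    rw [coe_ofComplex_I_mul ht]
    push_cast
    ring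
  have hc0 : (c : ℂ) ≠ 0 := by exact_mod_cast hc.ne'
  refine ⟨⟨c, Complex.I * (c * t : ℝ), hindep⟩, c, c * t, hc, by positivity, rfl, rfl, ?_, ?_⟩
  · rw [PeriodPair.g₂, PeriodPair.G_eq_mul_E _ _ hτ (k := 4) (by norm_num),
      E_ofComplex_I_mul _ (by decide) ht, ← hA4, Nat.cast_ofNat, riemannZeta_four]
    have hreal : 60 * ((c ^ 4)⁻¹ * (2 * (π ^ 4 / 90) * A ^ 2)) = g₂ := by
      rw [show c ^ 4 = (c ^ 2) ^ 2 by ring, hc2, ← hBg]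
      field_simp
      rw [hS3]
      norm_num
    dsimp only
    exact_mod_cast congrArg Complex.ofReal hreal
  · rw [PeriodPair.g₃, PeriodPair.G_eq_mul_E _ _ hτ (k := 6) (by norm_num),
      E_ofComplex_I_mul _ (by decide) ht, h6, Nat.cast_ofNat, riemannZeta_six]
    have hreal : 140 * ((c ^ 6)⁻¹ * (2 * (π ^ 6 / 945) * (3 * S * g₃ / B ^ 3 * A ^ 3))) = g₃ := by
      rw [show c ^ 6 = (c ^ 2) ^ 3 by ring, hc2]
      field_simp
      rw [show S ^ 4 = (S ^ 2) ^ 2 by ring, hS3]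
      norm_num
    dsimp only
    exact_mod_cast congrArg Complex.ofReal hreal

/-! ### The Weierstrass function on the line through a real half-period -/

namespace PeriodPair

variable (L : PeriodPair)

lemma conj_weierstrassP (hL : ∀ l ∈ L.lattice, starRingEnd ℂ l ∈ L.lattice) (z : ℂ) :
    starRingEnd ℂ (L.weierstrassP z) = L.weierstrassP (starRingEnd ℂ z) := by
  let e : L.lattice ≃ L.lattice :=
    { toFun := fun l => ⟨starRingEnd ℂ l, hL l l.2⟩
      invFun := fun l => ⟨starRingEnd ℂ l, hL l l.2⟩
      left_inv := fun l => by simp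
      right_inv := fun l => by simp }
  rw [weierstrassP, weierstrassP, Complex.conj_tsum, ← e.symm.tsum_eq]
  refine tsum_congr fun l => ?_
  simp [e]

lemma derivWeierstrassP_eq_zero_of_two_mul_mem {z : ℂ} (hz : 2 * z ∈ L.lattice) :
    L.derivWeierstrassP z = 0 := by
  have h := L.derivWeierstrassP_sub_coe z ⟨2 * z, hz⟩
  rw [show z - 2 * z = -z by ring, L.derivWeierstrassP_neg] at h
  exact CharZero.eq_neg_self_iff.mp h.symm

lemma hasDerivAt_weierstrassP {z : ℂ} (hz : z ∉ L.lattice) :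
    HasDerivAt L.weierstrassP (L.derivWeierstrassP z) z := by
  rw [← L.deriv_weierstrassP]
  exact (L.analyticOnNhd_weierstrassP z hz).differentiableAt.hasDerivAt

/-- The imaginary half-period of a rectangular lattice whose cubic has the roots
`-1/3` and `1/6 ± l/2`. -/
theorem imaginary_half_period_eq_integral {l a b : ℝ} (hl₀ : 0 < l) (hl₁ : l < 1)
    (ha : 0 < a) (hb : 0 < b)
    (hL : ∀ w, w ∈ L.lattice ↔ ∃ m n : ℤ, w = m * (2 * a) + n * (2 * (Complex.I * b)))
    (hg₂ : L.g₂ = ((l ^ 2 + 1 / 3 : ℝ) : ℂ)) (hg₃ : L.g₃ = ((l ^ 2 / 3 - 1 / 27 : ℝ) : ℂ)) :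
    b = ∫ θ in (0 : ℝ)..π, (√(2 * (1 + l * cos θ)))⁻¹ := by
  have hmem : ∀ x y : ℝ, (x : ℂ) + Complex.I * y ∈ L.lattice ↔
      ∃ m n : ℤ, x = m * (2 * a) ∧ y = n * (2 * b) := by
    intro x y
    rw [hL]
    refine exists₂_congr fun m n => ?_
    rw [Complex.ext_iff]
    simp
  have hconj : ∀ w ∈ L.lattice, starRingEnd ℂ w ∈ L.lattice := by
    intro w hw
    obtain ⟨m, n, rfl⟩ := (hL w).mp hw
    refine (hL _).mpr ⟨m, -n, ?_⟩
    simp [Complex.conj_ofNat]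
  have hnot : ∀ y : ℝ, (a : ℂ) + Complex.I * y ∉ L.lattice := by
    intro y h
    obtain ⟨m, -, hm, -⟩ := (hmem a y).mp h
    have h1 : (m : ℝ) * 2 = 1 := by
      have : a * (m * 2) = a * 1 := by linarith
      exact mul_left_cancel₀ ha.ne' this
    have h2 : m * 2 = 1 := by exact_mod_cast h1
    omega
  set Z : ℝ → ℂ := fun y => a + Complex.I * y with hZ
  have hZd : ∀ y, HasDerivAt Z Complex.I y := fun y => by
    have h := (((hasDerivAt_id y).ofReal_comp).const_mul Complex.I).const_add (a : ℂ)
    rwa [Complex.ofReal_one, mul_one] at h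
  have hreal : ∀ y, (L.weierstrassP (Z y)).im = 0 := by
    -- Conjugation sends `Z y` to `2a - Z y`, where the even, `2a`-periodic `℘` has the same value.
    intro y
    have h2a : ((2 * a : ℝ) : ℂ) ∈ L.lattice := by
      have := (hmem (2 * a) 0).mpr ⟨1, 0, by simp, by simp⟩
      simpa using this
    have h := L.conj_weierstrassP hconj (Z y)
    have e : starRingEnd ℂ (Z y) = -(Z y - ((2 * a : ℝ) : ℂ)) := by
      simp only [hZ, map_add, map_mul, Complex.conj_ofReal, Complex.conj_I]
      push_cast
      ring
    rw [e, L.weierstrassP_neg, L.weierstrassP_sub_coe (Z y) ⟨_, h2a⟩] at h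
    exact Complex.conj_eq_iff_im.mp h
  have hPd : ∀ y, HasDerivAt (fun y => L.weierstrassP (Z y))
      (L.derivWeierstrassP (Z y) * Complex.I) y := fun y =>
    HasDerivAt.comp (h₂ := L.weierstrassP) y (L.hasDerivAt_weierstrassP (hnot y)) (hZd y)
  set φ : ℝ → ℝ := fun y => (L.weierstrassP (Z y)).re with hφ
  set φ' : ℝ → ℝ := fun y => (L.derivWeierstrassP (Z y) * Complex.I).re with hφ'
  have hφd : ∀ y, HasDerivAt φ (φ' y) y := fun y =>
    Complex.reCLM.hasFDerivAt.comp_hasDerivAt y (hPd y)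
  have hP : ∀ y, L.weierstrassP (Z y) = φ y := fun y =>
    Complex.ext (by simp [hφ]) (by simp [hreal])
  have hP' : ∀ y, L.derivWeierstrassP (Z y) * Complex.I = φ' y := by
    intro y
    refine (hPd y).unique ?_
    simpa only [hP] using (hφd y).ofReal_comp
  have hode : ∀ y, φ' y ^ 2 = (φ y + 1 / 3) * (l ^ 2 - (2 * φ y - 1 / 3) ^ 2) := by
    intro y
    have h := L.derivWeierstrassP_sq (Z y) (hnot y)
    rw [hP, hg₂, hg₃] at h
    have h2 : ((φ' y : ℝ) : ℂ) ^ 2 = -(L.derivWeierstrassP (Z y)) ^ 2 := by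
      rw [← hP', mul_pow, Complex.I_sq]
      ring
    rw [h] at h2
    have h3 : φ' y ^ 2 = -(4 * φ y ^ 3 - (l ^ 2 + 1 / 3) * φ y - (l ^ 2 / 3 - 1 / 27)) := by
      exact_mod_cast h2
    rw [h3]
    ring
  have hzero : ∀ y : ℝ, φ' y = 0 ↔ L.derivWeierstrassP (Z y) = 0 := by
    intro y
    rw [← Complex.ofReal_eq_zero, ← hP']
    simp
  refine transit_time hl₀ hl₁ hb hφd hode ((hzero 0).mpr ?_) ((hzero b).mpr ?_) fun y hy h => ?_
  · refine L.derivWeierstrassP_eq_zero_of_two_mul_mem ((hL _).mpr ⟨1, 0, ?_⟩)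
    simp [hZ]
  · refine L.derivWeierstrassP_eq_zero_of_two_mul_mem ((hL _).mpr ⟨1, 1, ?_⟩)
    simp only [hZ]
    push_cast
    ring
  -- Taking both points equal to `Z y` puts `2 Z y` in the lattice, so `y` is an integral multiple
  -- of `b`.
  · have h2 := L.add_mem_lattice_of_derivWeierstrassP_eq_zero (hnot y) (hnot y)
      ((hzero y).mp h) rfl
    have e : (a + Complex.I * y : ℂ) + (a + Complex.I * y) =
        ((2 * a : ℝ) : ℂ) + Complex.I * ((2 * y : ℝ) : ℂ) := by
      push_cast
      ring
    rw [e, hmem] at h2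
    obtain ⟨-, n, -, hn⟩ := h2
    have h3 : y = n * b := by linarith
    have h4 : (0 : ℝ) < n := pos_of_mul_pos_left (h3 ▸ hy.1) hb.le
    have h5 : (n : ℝ) < 1 := by
      by_contra hn1
      have := mul_le_mul_of_nonneg_right (not_lt.mp hn1) hb.le
      linarith [hy.2]
    have h6 : 0 < n := by exact_mod_cast h4
    have h7 : n < 1 := by exact_mod_cast h5
    omega

end PeriodPair

/-! ### Existence and the formula for the half-period -/

theorem mainTheorem3 (κ : ℝ) (hκ₀ : 0 < κ) (hκ₁ : κ < 1) :
    (∃ (p : ℂ → ℂ) (ω ω' : ℂ), IsShenWeierstrass κ p ∧ IsNormalizedHalfPeriods p ω ω') ∧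
    ∀ (p : ℂ → ℂ), IsShenWeierstrass κ p → ∀ (ω ω' : ℂ),
      (IsNormalizedHalfPeriods (shenDn κ p) ω ω' ↔ IsNormalizedHalfPeriods p ω ω') ∧
      (IsNormalizedHalfPeriods p ω ω' →
        ω' = Complex.I *
          ((√2 * (π / 2) * ₂F₁ (1 / 4 : ℝ) (3 / 4 : ℝ) (1 : ℝ) (1 - κ ^ 2) : ℝ) : ℂ)) := by
  have hκ2 : 0 < 1 - κ ^ 2 := by nlinarith
  have hlsq : complementaryModulus κ ^ 2 = 1 - κ ^ 2 := sq_sqrt hκ2.le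
  have hl₀ : 0 < complementaryModulus κ := sqrt_pos.mpr hκ2
  have hl₁ : complementaryModulus κ < 1 := by
    refine lt_of_pow_lt_pow_left₀ 2 one_pos.le ?_
    rw [hlsq]
    nlinarith
  constructor
  · obtain ⟨L, a, b, ha, hb, h₁, h₂, hg₂, hg₃⟩ := exists_rectangular_periodPair
      (g₂ := complementaryModulus κ ^ 2 + 1 / 3) (g₃ := complementaryModulus κ ^ 2 / 3 - 1 / 27)
      (by positivity) (by
        -- This product is exactly `g₂³ - 27g₃²`.
        have : 0 < complementaryModulus κ ^ 2 * (1 - complementaryModulus κ ^ 2) ^ 2 := by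
          rw [hlsq]
          have : κ ≠ 0 := hκ₀.ne'
          have : 1 - (1 - κ ^ 2) ≠ 0 := by simpa
          positivity
        linarith)
    have e₁ : 2 * ((a / 2 : ℝ) : ℂ) = L.ω₁ := by rw [h₁]; push_cast; ring
    have e₂ : 2 * (Complex.I * (b / 2 : ℝ)) = L.ω₂ := by rw [h₂]; push_cast; ring
    refine ⟨L.weierstrassP, (a / 2 : ℝ), Complex.I * (b / 2 : ℝ), ⟨L, hg₂, hg₃, rfl⟩, ⟨?_, ?_⟩,
      ⟨by simpa using ha, by simp⟩, ⟨by simp, by simpa using hb⟩⟩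
    · rw [e₁, e₂]
      exact L.indep
    · intro w
      rw [e₁, e₂, L.isPeriodOf_weierstrassP_iff, PeriodPair.mem_lattice]
      simp only [eq_comm]
  · rintro p ⟨L, hg₂, hg₃, rfl⟩ ω ω'
    refine ⟨isNormalizedHalfPeriods_shenDn_iff hκ₀.ne' _ ω ω', ?_⟩
    rintro ⟨⟨-, hper⟩, ⟨hω, hω0⟩, hω'0, hω'⟩
    have e₁ : ω = (ω.re : ℂ) := Complex.ext (by simp) (by simp [hω0])
    have e₂ : ω' = Complex.I * (ω'.im : ℂ) := Complex.ext (by simp [hω'0]) (by simp)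
    have h := L.imaginary_half_period_eq_integral hl₀ hl₁ hω hω' (fun w => by
      rw [← L.isPeriodOf_weierstrassP_iff, hper, ← e₁, ← e₂]) hg₂ hg₃
    rw [integral_inv_sqrt_one_add_mul_cos hl₀.le hl₁, hlsq] at h
    rw [e₂, h]
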